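/- Let $\mathcal D$ be a probability distribution, let $f_\xi:\mathbb R^n\to\mathbb R$ be loss functions indexed by $\xi\sim\mathcal D$ with $\mathbb E_{\xi\sim\mathcal D}|f_\xi(W)|<\infty$ for all $W$, let $\psi:\mathbb R^n\to[-\infty,\infty]$, and put $F(W):=\mathbb E_{\xi\sim\mathcal D}[f_\xi(W)]+\psi(W)$. Write $\partial$ for the limiting subdifferential and $\mathcal Z:=\{W\mid 0\in\partial F(W)\}$ for the set of stationary points. RAMDA, with initial point $W^0$, constant $\epsilon>0$, learning rates $\eta_t>0$, weights $c_t\in[0,1]$ and tolerances $\epsilon_t$, sets $V^0=U^0=0$ and, for $t=1,2,\dots$, draws $\xi_t\sim\mathcal D$ independently of the past and sets $$s_t=\eta_t\sqrt t,\quad \alpha_t=\sum_{k=1}^t s_k,\quad G^t=\nabla f_{\xi_t}(W^{t-1}),\quad V^t=V^{t-1}+s_tG^t,\quad U^t=U^{t-1}+s_tG^t\circ G^t,\quad P^t=\mathrm{Diag}(\sqrt[3]{U^t}+\epsilon),$$ where $\circ$ is the entrywise product; it then computes, from the information available after drawing $\xi_t$, an approximate minimizer $\hat W^t$ of $$Q_t(W)=\alpha_t\psi(W)+\langle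 V^t,W\rangle+\tfrac12\langle W-W^0,P^t(W-W^0)\rangle$$ such that almost surely $$\min_{v\in\partial Q_t(\hat W^t)}\|v\|\le\epsilon_t,\qquad Q_t(\hat W^t)\le Q_t(W^{t-1}),$$ and sets $W^t=(1-c_t)W^{t-1}+c_t\hat W^t$. Assume that $\sum_t c_t=\infty$ and $\sum_t\epsilon_t^2<\infty$; that there is $L\ge0$ such that, for $\mathcal D$-almost every $\xi$, $f_\xi$ is differentiable with $L$-Lipschitz gradient; that there is $C\ge0$ with $\mathbb E\|\nabla f_{\xi_t}(W^{t-1})\|^4\le C$ for all $t\ge1$; and that $\mathcal Z\ne\emptyset$. Assume also that $$\sum_t \frac{s_t}{\alpha_t}=\infty,\qquad \sum_t\Big(\frac{s_t}{\alpha_t}\Big)^2<\infty,\qquad \|W^{t+1}-W^t\|\Big(\frac{s_t}{\alpha_t}\Big)^{-1}\xrightarrow{\text{a.s.}}0 .$$ Let $\bar W\in\mathbb R^n$ be such that $\partial\psi$ is outer semicontinuous at $\bar W$ (if $W_k\to\bar W$, $u_k\in\partial\psi(W_k)$ and $u_k\to u$, then $u\in\partial\psi(\bar W)$) and the event $\{\hat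 W^t\to\bar W\}$ has positive probability. Then, conditional on this event, $\bar W\in\mathcal Z$ with probability one. Moreover, on this event, $\{W^t\}$ also converges to $\bar W$. -/

import Mathlib

open MeasureTheory ProbabilityTheory Filter Topology
open scoped NNReal ENNReal

noncomputable section

/-! ### Variational analysis of extended-real-valued functions -/

/-- Regular (Fréchet) subdifferential of `φ` at `x`: `φ x` is finite and
`φ y ≥ φ x + ⟪v, y - x⟫ - o(‖y - x‖)` as `y → x`. It is empty where `φ` is not finite. -/
def regularSubdifferential {n : ℕ} (φ : EuclideanSpace ℝ (Fin n) → EReal)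
    (x : EuclideanSpace ℝ (Fin n)) : Set (EuclideanSpace ℝ (Fin n)) :=
  {v | φ x ≠ ⊤ ∧ φ x ≠ ⊥ ∧ ∀ δ : ℝ, 0 < δ → ∀ᶠ y in 𝓝 x,
    (((φ x).toReal + inner ℝ v (y - x) - δ * ‖y - x‖ : ℝ) : EReal) ≤ φ y}

/-- Limiting (Mordukhovich) subdifferential of `φ` at `x`: limits of regular subgradients
along sequences `x k → x` with `φ (x k) → φ x`. It is empty where `φ` is not finite. -/
def limitingSubdifferential {n : ℕ} (φ : EuclideanSpace ℝ (Fin n) → EReal)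
    (x : EuclideanSpace ℝ (Fin n)) : Set (EuclideanSpace ℝ (Fin n)) :=
  {v | φ x ≠ ⊤ ∧ φ x ≠ ⊥ ∧ ∃ y u : ℕ → EuclideanSpace ℝ (Fin n),
    Tendsto y atTop (𝓝 x) ∧ Tendsto (fun k => φ (y k)) atTop (𝓝 (φ x)) ∧
    (∀ k, u k ∈ regularSubdifferential φ (y k)) ∧ Tendsto u atTop (𝓝 v)}

/-- Outer semicontinuity at `x` of a set-valued map `S`: `limsup_{y → x} S y ⊆ S x`. -/
def OuterSemicontinuousAt {n : ℕ}
    (S : EuclideanSpace ℝ (Fin n) → Set (EuclideanSpace ℝ (Fin n)))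
    (x : EuclideanSpace ℝ (Fin n)) : Prop :=
  ∀ (y u : ℕ → EuclideanSpace ℝ (Fin n)) (v : EuclideanSpace ℝ (Fin n)),
    Tendsto y atTop (𝓝 x) → (∀ k, u k ∈ S (y k)) → Tendsto u atTop (𝓝 v) → v ∈ S x

/-- `g` is differentiable with `L`-Lipschitz gradient. -/
def IsLSmooth {n : ℕ} (L : ℝ≥0) (g : EuclideanSpace ℝ (Fin n) → ℝ) : Prop :=
  Differentiable ℝ g ∧ LipschitzWith L (gradient g)

/-! ### The regularized stochastic problem -/

/-- The objective `F W = 𝔼_{x ∼ D} [f x W] + ψ W`. -/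
def objective {n : ℕ} {X : Type*} [MeasurableSpace X] (D : Measure X)
    (f : X → EuclideanSpace ℝ (Fin n) → ℝ) (ψ : EuclideanSpace ℝ (Fin n) → EReal)
    (W : EuclideanSpace ℝ (Fin n)) : EReal :=
  ((∫ x, f x W ∂D : ℝ) : EReal) + ψ W

/-- The set of stationary points `{W | 0 ∈ ∂F W}`. -/
def stationarySet {n : ℕ} (F : EuclideanSpace ℝ (Fin n) → EReal) :
    Set (EuclideanSpace ℝ (Fin n)) :=
  {W | 0 ∈ limitingSubdifferential F W}

/-! ### RAMDA

Iterations are numbered `t = 1, 2, …`; the values of the parameter sequences at `0` play no role.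
The following definitions are along one sample path: `ξ` is the sequence of samples and `What`
the sequence of (approximate) subproblem solutions. -/

namespace RAMDA

/-- `s_t = η_t √t`. -/
def s (η : ℕ → ℝ) (t : ℕ) : ℝ := η t * √(t : ℝ)

/-- `α_t = s_1 + ⋯ + s_t`. -/
def α (η : ℕ → ℝ) (t : ℕ) : ℝ := ∑ k ∈ Finset.Icc 1 t, s η k

/-- `W^t = (1 - c_t) W^{t-1} + c_t What^t`, starting from `W^0`. -/
def iterate {n : ℕ} (c : ℕ → ℝ) (W0 : EuclideanSpace ℝ (Fin n))
    (What : ℕ → EuclideanSpace ℝ (Fin n)) : ℕ → EuclideanSpace ℝ (Fin n)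
  | 0 => W0
  | t + 1 => (1 - c (t + 1)) • iterate c W0 What t + c (t + 1) • What (t + 1)

/-- The stochastic gradient `G^t = ∇f_{ξ_t}(W^{t-1})`, for `t ≥ 1`. -/
def G {n : ℕ} {X : Type*} (f : X → EuclideanSpace ℝ (Fin n) → ℝ) (c : ℕ → ℝ)
    (W0 : EuclideanSpace ℝ (Fin n)) (ξ : ℕ → X) (What : ℕ → EuclideanSpace ℝ (Fin n))
    (t : ℕ) : EuclideanSpace ℝ (Fin n) :=
  gradient (f (ξ t)) (iterate c W0 What (t - 1))

/-- `V^0 = 0`, `V^t = V^{t-1} + s_t G^t`. -/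
def V {n : ℕ} {X : Type*} (f : X → EuclideanSpace ℝ (Fin n) → ℝ) (η c : ℕ → ℝ)
    (W0 : EuclideanSpace ℝ (Fin n)) (ξ : ℕ → X) (What : ℕ → EuclideanSpace ℝ (Fin n)) :
    ℕ → EuclideanSpace ℝ (Fin n)
  | 0 => 0
  | t + 1 => V f η c W0 ξ What t + s η (t + 1) • G f c W0 ξ What (t + 1)

/-- The Hadamard (entrywise) product. -/
def hadamard {n : ℕ} (x y : EuclideanSpace ℝ (Fin n)) : EuclideanSpace ℝ (Fin n) :=
  WithLp.toLp 2 fun i => x i * y i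

/-- `U^0 = 0`, `U^t = U^{t-1} + s_t G^t ∘ G^t`. -/
def U {n : ℕ} {X : Type*} (f : X → EuclideanSpace ℝ (Fin n) → ℝ) (η c : ℕ → ℝ)
    (W0 : EuclideanSpace ℝ (Fin n)) (ξ : ℕ → X) (What : ℕ → EuclideanSpace ℝ (Fin n)) :
    ℕ → EuclideanSpace ℝ (Fin n)
  | 0 => 0
  | t + 1 => U f η c W0 ξ What t +
      s η (t + 1) • hadamard (G f c W0 ξ What (t + 1)) (G f c W0 ξ What (t + 1))

/-- The preconditioner `P^t = Diag(∛(U^t) + ε)`; the entries of `U^t` are nonnegative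
when the step sizes are. -/
def P {n : ℕ} {X : Type*} (f : X → EuclideanSpace ℝ (Fin n) → ℝ) (η c : ℕ → ℝ) (ε : ℝ)
    (W0 : EuclideanSpace ℝ (Fin n)) (ξ : ℕ → X) (What : ℕ → EuclideanSpace ℝ (Fin n))
    (t : ℕ) : Matrix (Fin n) (Fin n) ℝ :=
  Matrix.diagonal fun i => (U f η c W0 ξ What t i) ^ (1 / 3 : ℝ) + ε

/-- The subproblem objective
`Q_t(W) = α_t ψ(W) + ⟪V^t, W⟫ + (1/2) ⟪W - W^0, P^t (W - W^0)⟫`. -/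
def Q {n : ℕ} {X : Type*} (f : X → EuclideanSpace ℝ (Fin n) → ℝ)
    (ψ : EuclideanSpace ℝ (Fin n) → EReal) (η c : ℕ → ℝ) (ε : ℝ)
    (W0 : EuclideanSpace ℝ (Fin n)) (ξ : ℕ → X) (What : ℕ → EuclideanSpace ℝ (Fin n))
    (t : ℕ) (W : EuclideanSpace ℝ (Fin n)) : EReal :=
  (α η t : EReal) * ψ W + ((inner ℝ (V f η c W0 ξ What t) W +
    1 / 2 * inner ℝ (W - W0)
      (Matrix.toEuclideanLin (P f η c ε W0 ξ What t) (W - W0)) : ℝ) : EReal)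

/-- The inexactness condition at iteration `t`, with tolerance `e t`:
`min_{v ∈ ∂Q_t(What^t)} ‖v‖ ≤ e t` and `Q_t(What^t) ≤ Q_t(W^{t-1})`. -/
def Inexact {n : ℕ} {X : Type*} (f : X → EuclideanSpace ℝ (Fin n) → ℝ)
    (ψ : EuclideanSpace ℝ (Fin n) → EReal) (η c e : ℕ → ℝ) (ε : ℝ)
    (W0 : EuclideanSpace ℝ (Fin n)) (ξ : ℕ → X) (What : ℕ → EuclideanSpace ℝ (Fin n))
    (t : ℕ) : Prop :=
  (∃ v ∈ limitingSubdifferential (Q f ψ η c ε W0 ξ What t) (What t), ‖v‖ ≤ e t) ∧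
  Q f ψ η c ε W0 ξ What t (What t) ≤ Q f ψ η c ε W0 ξ What t (iterate c W0 What (t - 1))

/-- `(ξ, What)` is a random run of RAMDA started at `W0` on the probability space `(Ω, μ)`.
`ℱ t` is the information available after iteration `t`: the sample `ξ_t` has law `D`, is drawn
independently of the past, and `What^t` is computed from what is known after drawing `ξ_t`
(possibly with further randomization) so that the inexactness condition holds. -/
structure IsRun {n : ℕ} {X Ω : Type*} [MeasurableSpace X] {mΩ : MeasurableSpace Ω}
    (μ : Measure Ω) (ℱ : Filtration ℕ mΩ) (D : Measure X)
    (f : X → EuclideanSpace ℝ (Fin n) → ℝ) (ψ : EuclideanSpace ℝ (Fin n) → EReal)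
    (η c e : ℕ → ℝ) (ε : ℝ) (W0 : EuclideanSpace ℝ (Fin n))
    (ξ : ℕ → Ω → X) (What : ℕ → Ω → EuclideanSpace ℝ (Fin n)) : Prop where
  sample_measurable : ∀ t, 1 ≤ t → Measurable[ℱ t] (ξ t)
  sample_law : ∀ t, 1 ≤ t → μ.map (ξ t) = D
  sample_indep : ∀ t, 1 ≤ t → Indep (MeasurableSpace.comap (ξ t) inferInstance) (ℱ (t - 1)) μ
  adapted : ∀ t, 1 ≤ t → Measurable[ℱ t] (What t)
  inexact : ∀ᵐ ω ∂μ, ∀ t, 1 ≤ t →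
    Inexact f ψ η c e ε W0 (fun k => ξ k ω) (fun k => What k ω) t

end RAMDA

end

/-!
Write `fbar W = 𝔼 f_x(W)`. On the event `What^t → Wbar` the iterates converge to `Wbar` as well,
because they are running convex combinations of the `What^t` with `∑ c_t = ∞`
(`RAMDA.tendsto_iterate`). For the stationarity of `Wbar`, divide the inexact optimality condition
of the subproblem by `α_t`: a vector of norm at most `ε_t / α_t` equals

  `u_t + V^t / α_t + (P^t / α_t) (What^t - W^0)`  with  `u_t ∈ ∂ψ(What^t)`.

If `V^t / α_t → ∇fbar(Wbar)` and `P^t / α_t → 0`, then `u_t → -∇fbar(Wbar)`, outer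
semicontinuity gives `-∇fbar(Wbar) ∈ ∂ψ(Wbar)`, and the smooth sum rule
(`smul_add_gradient_mem_limitingSubdifferential`) turns this into `0 ∈ ∂F(Wbar)`.

Both limits are needed only along one subsequence on one sample path, so convergence in mean is
enough and no almost sure martingale convergence theorem enters.

* `V^t` is the sum of a weighted sum of `∇fbar(W^{k-1})`, whose average converges by continuity
  and a Toeplitz argument (`RAMDA.tendsto_V_sub_noise`), and of a martingale `M_t`, with
  `𝔼 ‖M_t‖² ≤ K ∑_{k ≤ t} s_k²` by orthogonality of its increments
  (`accumulatedNoise_memLp_and_integral_le`). The conditions on `s_t / α_t` make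
  `∑_{k ≤ t} s_k² / α_t²` tend to zero (`RAMDA.tendsto_sum_sq_div_α_sq`).
* The entries of `P^t` are `∛(U^t) + ε`, and `∛(U^t) / α_t = ∛(U^t / α_t³)` with
  `𝔼 U^t ≤ K α_t`; moreover `α_t → ∞` (`RAMDA.tendsto_α`).

`RAMDA.exists_subseq_remainder_tendsto_zero` extracts the common subsequence.
-/

/-! ### Averaging recursions -/

/-- Iterating the recursion bounds `a t` by `δ + a T₀ * exp (-∑ β)`, the sum starting after `T₀`, once
`b ≤ δ` from `T₀` on; the exponential dies out because `∑ β = ∞`. -/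
theorem tendsto_zero_of_le_convex_comb {β a b : ℕ → ℝ}
    (hβ : ∀ t, 1 ≤ t → β t ∈ Set.Icc (0 : ℝ) 1)
    (hsum : Tendsto (fun T => ∑ t ∈ Finset.Icc 1 T, β t) atTop atTop)
    (ha : ∀ t, 0 ≤ a t) (hb : Tendsto b atTop (𝓝 0))
    (hrec : ∀ t, a (t + 1) ≤ (1 - β (t + 1)) * a t + β (t + 1) * b (t + 1)) :
    Tendsto a atTop (𝓝 0) := by
  rw [Metric.tendsto_atTop]
  intro δ hδ
  obtain ⟨T₀, hT₀⟩ := eventually_atTop.1 (hb.eventually_le_const (half_pos hδ))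
  set S : ℕ → ℝ := fun T => ∑ t ∈ Finset.Icc 1 T, β t with hS
  have key : ∀ t, T₀ ≤ t → a t ≤ δ / 2 + a T₀ * Real.exp (S T₀ - S t) := by
    intro t ht
    induction t, ht using Nat.le_induction with
    | base => simpa using (half_pos hδ).le
    | succ t ht ih =>
      obtain ⟨h0, h1⟩ := hβ (t + 1) (by omega)
      have hSt : S (t + 1) = S t + β (t + 1) := Finset.sum_Icc_succ_top (by omega) _
      have hexp : 1 - β (t + 1) ≤ Real.exp (-β (t + 1)) := by
        have := Real.add_one_le_exp (-β (t + 1)); linarith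
      have hpos : 0 ≤ a T₀ * Real.exp (S T₀ - S t) := mul_nonneg (ha _) (Real.exp_pos _).le
      calc a (t + 1) ≤ (1 - β (t + 1)) * a t + β (t + 1) * b (t + 1) := hrec t
        _ ≤ (1 - β (t + 1)) * (δ / 2 + a T₀ * Real.exp (S T₀ - S t)) + β (t + 1) * (δ / 2) :=
            add_le_add (mul_le_mul_of_nonneg_left ih (by linarith))
              (mul_le_mul_of_nonneg_left (hT₀ _ (by omega)) h0)
        _ = δ / 2 + (1 - β (t + 1)) * (a T₀ * Real.exp (S T₀ - S t)) := by ring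
        _ ≤ δ / 2 + Real.exp (-β (t + 1)) * (a T₀ * Real.exp (S T₀ - S t)) := by gcongr
        _ = δ / 2 + a T₀ * Real.exp (S T₀ - S (t + 1)) := by
            rw [hSt, show S T₀ - (S t + β (t + 1)) = -β (t + 1) + (S T₀ - S t) by ring,
              Real.exp_add]
            ring
  have hlim : Tendsto (fun t => a T₀ * Real.exp (S T₀ - S t)) atTop (𝓝 0) := by
    have h1 : Tendsto (fun t => S T₀ - S t) atTop atBot :=
      tendsto_atBot_add_const_left _ _ (tendsto_neg_atTop_atBot.comp hsum)
    simpa using (Real.tendsto_exp_atBot.comp h1).const_mul (a T₀)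
  obtain ⟨T₁, hT₁⟩ := eventually_atTop.1 (hlim.eventually_lt_const (half_pos hδ))
  refine ⟨max T₀ T₁, fun t ht => ?_⟩
  rw [Real.dist_eq, sub_zero, abs_of_nonneg (ha t)]
  have h1 := key t (le_trans (le_max_left _ _) ht)
  have h2 := hT₁ t (le_trans (le_max_right _ _) ht)
  linarith

theorem tendsto_zero_of_summable_sq {b : ℕ → ℝ} (h : Summable fun t => b t ^ 2) :
    Tendsto b atTop (𝓝 0) := by
  have h := h.tendsto_atTop_zero.sqrt
  simp only [Real.sqrt_sq_eq_abs, Real.sqrt_zero] at h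
  exact (tendsto_zero_iff_abs_tendsto_zero _).2 h

namespace RAMDA

variable {η : ℕ → ℝ}

theorem s_pos (hη : ∀ t, 1 ≤ t → 0 < η t) {t : ℕ} (ht : 1 ≤ t) : 0 < s η t :=
  mul_pos (hη t ht) (Real.sqrt_pos.2 (by exact_mod_cast ht))

theorem α_zero (η : ℕ → ℝ) : α η 0 = 0 := by simp [α]

theorem α_succ (η : ℕ → ℝ) (t : ℕ) : α η (t + 1) = α η t + s η (t + 1) :=
  Finset.sum_Icc_succ_top (by omega) _

theorem α_nonneg (hη : ∀ t, 1 ≤ t → 0 < η t) (t : ℕ) : 0 ≤ α η t :=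
  Finset.sum_nonneg fun _ hk => (s_pos hη (Finset.mem_Icc.1 hk).1).le

theorem α_pos (hη : ∀ t, 1 ≤ t → 0 < η t) {t : ℕ} (ht : 1 ≤ t) : 0 < α η t := by
  obtain ⟨t, rfl⟩ := Nat.exists_eq_add_of_le' ht
  rw [α_succ]
  exact add_pos_of_nonneg_of_pos (α_nonneg hη t) (s_pos hη (by omega))

theorem α_mono (hη : ∀ t, 1 ≤ t → 0 < η t) : Monotone (α η) :=
  monotone_nat_of_le_succ fun t => by
    rw [α_succ]; linarith [s_pos hη (t := t + 1) (by omega)]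

theorem s_div_α_mem_Icc (hη : ∀ t, 1 ≤ t → 0 < η t) (t : ℕ) (ht : 1 ≤ t) :
    s η t / α η t ∈ Set.Icc (0 : ℝ) 1 := by
  refine ⟨(div_pos (s_pos hη ht) (α_pos hη ht)).le, (div_le_one (α_pos hη ht)).2 ?_⟩
  obtain ⟨t, rfl⟩ := Nat.exists_eq_add_of_le' ht
  rw [α_succ]
  linarith [α_nonneg hη t]

/-- If `α` were bounded, `∑ s_t / α_t ≤ (∑ s_t) / α_1` would be bounded too. -/
theorem tendsto_α (hη : ∀ t, 1 ≤ t → 0 < η t)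
    (hs_sum : Tendsto (fun T => ∑ t ∈ Finset.Icc 1 T, s η t / α η t) atTop atTop) :
    Tendsto (α η) atTop atTop := by
  have h1 := α_pos hη le_rfl
  refine tendsto_atTop_mono (fun T => ?_) (hs_sum.const_mul_atTop h1)
  rw [Finset.mul_sum]
  refine Finset.sum_le_sum fun t ht => ?_
  have ht := (Finset.mem_Icc.1 ht).1
  rw [mul_div_assoc', div_le_iff₀ (α_pos hη ht), mul_comm]
  exact mul_le_mul_of_nonneg_left (α_mono hη ht) (s_pos hη ht).le

/-- Weighted averages, with weights `s_t`, of a sequence tending to `0` tend to `0`. -/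
theorem tendsto_div_α (hη : ∀ t, 1 ≤ t → 0 < η t)
    (hs_sum : Tendsto (fun T => ∑ t ∈ Finset.Icc 1 T, s η t / α η t) atTop atTop)
    {p b : ℕ → ℝ} (hp : ∀ t, 0 ≤ p t) (hp0 : p 0 = 0) (hb : Tendsto b atTop (𝓝 0))
    (hrec : ∀ t, p (t + 1) ≤ p t + s η (t + 1) * b (t + 1)) :
    Tendsto (fun t => p t / α η t) atTop (𝓝 0) := by
  refine tendsto_zero_of_le_convex_comb (s_div_α_mem_Icc hη) hs_sum
    (fun t => div_nonneg (hp t) (α_nonneg hη t)) hb fun t => ?_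
  have hα := α_pos hη (t := t + 1) (by omega)
  have hw : 1 - s η (t + 1) / α η (t + 1) = α η t / α η (t + 1) := by
    rw [eq_div_iff hα.ne', sub_mul, div_mul_cancel₀ _ hα.ne', α_succ]; ring
  have hpα : α η t * (p t / α η t) = p t := by
    rcases Nat.eq_zero_or_pos t with rfl | ht
    · simp [hp0]
    · exact mul_div_cancel₀ _ (α_pos hη ht).ne'
  rw [hw, div_mul_eq_mul_div, hpα, div_mul_eq_mul_div, ← add_div]
  exact div_le_div_of_nonneg_right (hrec t) hα.le

/-- The squared normalized step sizes vanish: apply `tendsto_div_α` to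
`(∑ k ≤ t, s_k ^ 2) / α_t`, whose increments are at most `s_t * (s_t / α_t)`. -/
theorem tendsto_sum_sq_div_α_sq (hη : ∀ t, 1 ≤ t → 0 < η t)
    (hs_sum : Tendsto (fun T => ∑ t ∈ Finset.Icc 1 T, s η t / α η t) atTop atTop)
    (hs_sq : Summable fun t => (s η t / α η t) ^ 2) :
    Tendsto (fun t => (∑ k ∈ Finset.range t, s η (k + 1) ^ 2) / α η t ^ 2) atTop (𝓝 0) := by
  have hβ := tendsto_zero_of_summable_sq hs_sq
  have hq : ∀ t, 0 ≤ ∑ k ∈ Finset.range t, s η (k + 1) ^ 2 :=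
    fun t => Finset.sum_nonneg fun _ _ => sq_nonneg _
  have := tendsto_div_α hη hs_sum
    (p := fun t => (∑ k ∈ Finset.range t, s η (k + 1) ^ 2) / α η t)
    (fun t => div_nonneg (hq t) (α_nonneg hη t)) (by simp) hβ (fun t => ?_)
  · refine this.congr fun t => ?_
    rw [div_div, sq (α η t)]
  · have hα := α_pos hη (t := t + 1) (by omega)
    rw [Finset.sum_range_succ, add_div, sq (s η (t + 1)), mul_div_assoc (s η (t + 1))]
    gcongr ?_ + _
    rcases Nat.eq_zero_or_pos t with rfl | ht
    · simp
    · exact div_le_div_of_nonneg_left (hq t) (α_pos hη ht) (α_mono hη (Nat.le_succ t))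

/-- Since `∑ c_t = ∞`, the iterates inherit the limit of the subproblem solutions. -/
theorem tendsto_iterate {n : ℕ} {c : ℕ → ℝ} (hc : ∀ t, 1 ≤ t → c t ∈ Set.Icc (0 : ℝ) 1)
    (hc_sum : Tendsto (fun T => ∑ t ∈ Finset.Icc 1 T, c t) atTop atTop)
    (W0 : EuclideanSpace ℝ (Fin n)) {What : ℕ → EuclideanSpace ℝ (Fin n)}
    {Wbar : EuclideanSpace ℝ (Fin n)} (h : Tendsto What atTop (𝓝 Wbar)) :
    Tendsto (iterate c W0 What) atTop (𝓝 Wbar) := by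
  rw [tendsto_iff_norm_sub_tendsto_zero] at h ⊢
  refine tendsto_zero_of_le_convex_comb hc hc_sum (fun _ => norm_nonneg _) h fun t => ?_
  obtain ⟨h0, h1⟩ := hc (t + 1) (by omega)
  have : iterate c W0 What (t + 1) - Wbar =
      (1 - c (t + 1)) • (iterate c W0 What t - Wbar) + c (t + 1) • (What (t + 1) - Wbar) := by
    rw [iterate]; module
  rw [this]
  refine (norm_add_le _ _).trans_eq ?_
  rw [norm_smul, norm_smul, Real.norm_of_nonneg h0, Real.norm_of_nonneg (by linarith)]

end RAMDA

/-! ### Subdifferential calculus -/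

section Subdifferential

variable {n : ℕ}

/-- The regular subdifferential under a positive scaling and a differentiable perturbation. The
products and sums in `EReal` are never indeterminate, since `0 < a` and `g` is finite. -/
theorem smul_add_gradient_mem_regularSubdifferential
    {φ : EuclideanSpace ℝ (Fin n) → EReal} {g : EuclideanSpace ℝ (Fin n) → ℝ}
    {x v w : EuclideanSpace ℝ (Fin n)} {a : ℝ} (ha : 0 < a) (hg : HasGradientAt g w x)
    (hv : v ∈ regularSubdifferential φ x) :
    a • v + w ∈ regularSubdifferential (fun y => (a : EReal) * φ y + (g y : EReal)) x := by
  obtain ⟨htop, hbot, hv⟩ := hv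
  lift φ x to ℝ using ⟨htop, hbot⟩ with r hr
  refine ⟨?_, ?_, fun δ hδ => ?_⟩
  · beta_reduce; rw [← hr]; exact EReal.coe_ne_top (a * r + g x)
  · beta_reduce; rw [← hr]; exact EReal.coe_ne_bot (a * r + g x)
  have hgx : ∀ᶠ y in 𝓝 x, ‖g y - g x - inner ℝ w (y - x)‖ ≤ δ / 2 * ‖y - x‖ :=
    (hasGradientAt_iff_isLittleO.1 hg).def (half_pos hδ)
  filter_upwards [hv (δ / 2 / a) (by positivity), hgx] with y hy hgy
  have hx : ((a : EReal) * (r : EReal) + (g x : EReal)).toReal = a * r + g x :=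
    EReal.toReal_coe (a * r + g x)
  simp only [← hr, hx]
  rw [EReal.toReal_coe] at hy
  induction hφ : φ y with
  | bot => rw [hφ] at hy; exact absurd (le_bot_iff.1 hy) (EReal.coe_ne_bot _)
  | top => rw [EReal.coe_mul_top_of_pos ha, EReal.top_add_coe]; exact le_top
  | coe q =>
    rw [hφ, EReal.coe_le_coe_iff] at hy
    have hgy' := (abs_le.1 hgy).1
    have h1 := mul_le_mul_of_nonneg_left hy ha.le
    have h2 : a * (δ / 2 / a * ‖y - x‖) = δ / 2 * ‖y - x‖ := by field_simp
    refine EReal.coe_le_coe_iff.2 (show _ ≤ a * q + g y from ?_)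
    rw [inner_add_left, real_inner_smul_left]
    linarith

/-- One inclusion of the smooth sum rule: `a ∂φ(x) + ∇g(x) ⊆ ∂(a φ + g)(x)` for `g` of class
`C¹`. The other one is this inclusion applied to the scaling `a⁻¹` and the perturbation `-a⁻¹ g`. -/
theorem smul_add_gradient_mem_limitingSubdifferential
    {φ : EuclideanSpace ℝ (Fin n) → EReal} {g : EuclideanSpace ℝ (Fin n) → ℝ}
    {g' : EuclideanSpace ℝ (Fin n) → EuclideanSpace ℝ (Fin n)}
    {x v : EuclideanSpace ℝ (Fin n)} {a : ℝ} (ha : 0 < a)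
    (hg : ∀ y, HasGradientAt g (g' y) y) (hg' : Continuous g')
    (hv : v ∈ limitingSubdifferential φ x) :
    a • v + g' x ∈ limitingSubdifferential (fun y => (a : EReal) * φ y + (g y : EReal)) x := by
  obtain ⟨htop, hbot, y, u, hy, hφ, hu, huv⟩ := hv
  have hgc : Continuous g := continuous_iff_continuousAt.2 fun y => (hg y).continuousAt
  lift φ x to ℝ using ⟨htop, hbot⟩ with r hr
  refine ⟨?_, ?_, y, fun k => a • u k + g' (y k), hy, ?_,
    fun k => smul_add_gradient_mem_regularSubdifferential ha (hg _) (hu k),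
    (huv.const_smul a).add ((hg'.tendsto x).comp hy)⟩
  · beta_reduce; rw [← hr]; exact EReal.coe_ne_top (a * r + g x)
  · beta_reduce; rw [← hr]; exact EReal.coe_ne_bot (a * r + g x)
  · beta_reduce
    rw [← hr]
    have h1 : Tendsto (fun k => (a : EReal) * φ (y k)) atTop (𝓝 ((a : EReal) * (r : EReal))) :=
      EReal.Tendsto.const_mul hφ (Or.inl (EReal.coe_ne_bot _)) (Or.inl (EReal.coe_ne_top _))
    have h2 : Tendsto (fun k => (g (y k) : EReal)) atTop (𝓝 (g x : EReal)) :=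
      EReal.tendsto_coe.2 ((hgc.tendsto x).comp hy)
    have h3 : ContinuousAt (fun p : EReal × EReal => p.1 + p.2)
        ((a : EReal) * (r : EReal), (g x : EReal)) :=
      EReal.continuousAt_add (Or.inr (EReal.coe_ne_bot _)) (Or.inr (EReal.coe_ne_top _))
    exact h3.tendsto.comp (h1.prodMk_nhds h2)

/-- Converse of `smul_add_gradient_mem_limitingSubdifferential`: `φ` is recovered from
`a φ + g` even where it is infinite. -/
theorem inv_smul_sub_gradient_mem_limitingSubdifferential
    {φ : EuclideanSpace ℝ (Fin n) → EReal} {g : EuclideanSpace ℝ (Fin n) → ℝ}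
    {g' : EuclideanSpace ℝ (Fin n) → EuclideanSpace ℝ (Fin n)}
    {x v : EuclideanSpace ℝ (Fin n)} {a : ℝ} (ha : 0 < a)
    (hg : ∀ y, HasGradientAt g (g' y) y) (hg' : Continuous g')
    (hv : v ∈ limitingSubdifferential (fun y => (a : EReal) * φ y + (g y : EReal)) x) :
    a⁻¹ • (v - g' x) ∈ limitingSubdifferential φ x := by
  have hg2 : ∀ y, HasGradientAt (fun y => -a⁻¹ * g y) ((-a⁻¹) • g' y) y := fun y => by
    rw [hasGradientAt_iff_hasFDerivAt, map_smulₛₗ]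
    simpa using (hg y).hasFDerivAt.const_mul (-a⁻¹)
  have h := smul_add_gradient_mem_limitingSubdifferential (inv_pos.2 ha) hg2
    (hg'.const_smul (-a⁻¹)) hv
  have hφ : (fun y => ((a⁻¹ : ℝ) : EReal) * ((a : EReal) * φ y + (g y : EReal)) +
      ((-a⁻¹ * g y : ℝ) : EReal)) = φ := by
    funext y
    induction φ y with
    | bot =>
      rw [EReal.coe_mul_bot_of_pos ha, EReal.bot_add, EReal.coe_mul_bot_of_pos (inv_pos.2 ha),
        EReal.bot_add]
    | top =>
      rw [EReal.coe_mul_top_of_pos ha, EReal.top_add_coe, EReal.coe_mul_top_of_pos (inv_pos.2 ha),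
        EReal.top_add_coe]
    | coe q =>
      have : a⁻¹ * (a * q + g y) + -a⁻¹ * g y = q := by field_simp; ring
      exact_mod_cast this
  rw [hφ] at h
  convert h using 1
  module

/-- The gradient of the smooth part of the subproblem objective. -/
theorem hasGradientAt_linear_add_quadratic (v w₀ : EuclideanSpace ℝ (Fin n)) (d : Fin n → ℝ)
    (w : EuclideanSpace ℝ (Fin n)) :
    HasGradientAt (fun w => inner ℝ v w +
        1 / 2 * inner ℝ (w - w₀) (Matrix.toEuclideanLin (Matrix.diagonal d) (w - w₀)))
      (v + Matrix.toEuclideanLin (Matrix.diagonal d) (w - w₀)) w := by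
  set T := (Matrix.toEuclideanLin (Matrix.diagonal d)).toContinuousLinearMap with hT
  have hsymm : ∀ x y, inner ℝ x (T y) = inner ℝ (T x) y := fun x y => by
    simp [hT, PiLp.inner_apply, Matrix.mulVec_diagonal]
    exact Finset.sum_congr rfl fun i _ => by ring
  have h1 : HasFDerivAt (fun w => w - w₀) (ContinuousLinearMap.id ℝ _) w :=
    (hasFDerivAt_id w).sub_const w₀
  have h2 := (((h1.inner ℝ (T.hasFDerivAt.comp w h1)).const_mul (1 / 2))).add
    (innerSL ℝ v).hasFDerivAt
  rw [hasGradientAt_iff_hasFDerivAt]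
  refine (h2.congr_fderiv ?_).congr_of_eventuallyEq (.of_forall fun w => ?_)
  · ext y
    change 1 / 2 * (inner ℝ (w - w₀) (T y) + inner ℝ y (T (w - w₀))) + inner ℝ v y =
      inner ℝ (v + T (w - w₀)) y
    rw [hsymm, real_inner_comm _ y, inner_add_left]
    ring
  · simp [hT, add_comm]

end Subdifferential

/-! ### Mean-square estimates for the gradient noise -/

section Noise

variable {E X Ω : Type*} [NormedAddCommGroup E]
  [MeasurableSpace X] {m mΩ : MeasurableSpace Ω} {μ : Measure Ω} {D : Measure X}

theorem memLp_two_of_lintegral_enorm_sq_lt_top {u : Ω → E} (hu : AEStronglyMeasurable u μ)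
    (h : ∫⁻ ω, ‖u ω‖ₑ ^ 2 ∂μ < ∞) : MemLp u 2 μ := by
  rw [memLp_two_iff_integrable_sq_norm hu]
  refine ⟨(hu.norm.pow 2), ?_⟩
  simpa [HasFiniteIntegral, enorm_pow] using h

theorem lintegral_enorm_sq_eq_ofReal_integral {u : Ω → E} (hu : MemLp u 2 μ) :
    ∫⁻ ω, ‖u ω‖ₑ ^ 2 ∂μ = ENNReal.ofReal (∫ ω, ‖u ω‖ ^ 2 ∂μ) := by
  rw [ofReal_integral_eq_lintegral_ofReal
    ((memLp_two_iff_integrable_sq_norm hu.1).1 hu) (.of_forall fun _ => sq_nonneg _)]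
  refine lintegral_congr fun ω => ?_
  rw [ENNReal.ofReal_pow (norm_nonneg _), ofReal_norm]

theorem integral_norm_sq_le_of_lintegral_le {u : Ω → E} (hu : MemLp u 2 μ) {K : ℝ≥0}
    (h : ∫⁻ ω, ‖u ω‖ₑ ^ 2 ∂μ ≤ K) : ∫ ω, ‖u ω‖ ^ 2 ∂μ ≤ K := by
  rw [lintegral_enorm_sq_eq_ofReal_integral hu] at h
  simpa using (ENNReal.ofReal_le_iff_le_toReal ENNReal.coe_ne_top).1 h

/-- Convergence in `L¹` gives almost sure convergence along a subsequence. -/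
theorem exists_subseq_ae_tendsto_zero {R : ℕ → Ω → ℝ} (hR : ∀ t, Integrable (R t) μ)
    (hR0 : ∀ t ω, 0 ≤ R t ω) (hlim : Tendsto (fun t => ∫ ω, R t ω ∂μ) atTop (𝓝 0)) :
    ∃ ns : ℕ → ℕ, StrictMono ns ∧ ∀ᵐ ω ∂μ, Tendsto (fun k => R (ns k) ω) atTop (𝓝 0) := by
  refine (tendstoInMeasure_of_tendsto_eLpNorm (p := 1) (g := fun _ => (0 : ℝ)) one_ne_zero
    (fun t => (hR t).1) aestronglyMeasurable_const ?_).exists_seq_tendsto_ae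
  have h := ENNReal.tendsto_ofReal hlim
  rw [ENNReal.ofReal_zero] at h
  refine h.congr fun t => ?_
  rw [eLpNorm_one_eq_lintegral_enorm, ← ofReal_integral_norm_eq_lintegral_enorm]
  · refine congrArg _ (integral_congr_ae (.of_forall fun ω => ?_))
    simp [abs_of_nonneg (hR0 t ω)]
  · exact (hR t).sub (integrable_zero _ _ _)

/-- A fresh sample and a quantity determined by the past have a product law. -/
theorem map_prodMk_eq_prod_of_indep {F : Type*} [MeasurableSpace F] [IsFiniteMeasure μ]
    (hm : m ≤ mΩ) {ξ : Ω → X} (hξ : Measurable ξ)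
    (hind : Indep (MeasurableSpace.comap ξ inferInstance) m μ) {Y : Ω → F}
    (hY : Measurable[m] Y) :
    μ.map (fun ω => (ξ ω, Y ω)) = (μ.map ξ).prod (μ.map Y) := by
  have h : IndepFun ξ Y μ := by
    rw [IndepFun_iff_Indep]
    exact indep_of_indep_of_le_right hind hY.comap_le
  exact h.map_prod_eq_prod_map_map hξ.aemeasurable (hY.mono hm le_rfl).aemeasurable

variable [InnerProductSpace ℝ E]

/-- The noise accumulated over `t` steps with weights `s`: the martingale with increments
`s_{k+1} (g(ξ_{k+1}, w_k) - 𝔼_x g(x, w_k))`. -/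
noncomputable def accumulatedNoise (D : Measure X) (g : X → E → E) (s : ℕ → ℝ) (ξ : ℕ → X) (w : ℕ → E)
    (t : ℕ) : E :=
  ∑ k ∈ Finset.range t, s (k + 1) • (g (ξ (k + 1)) (w k) - ∫ x, g x (w k) ∂D)

theorem accumulatedNoise_succ (g : X → E → E) (s : ℕ → ℝ) (ξ : ℕ → X) (w : ℕ → E) (t : ℕ) :
    accumulatedNoise D g s ξ w (t + 1) = accumulatedNoise D g s ξ w t +
      s (t + 1) • (g (ξ (t + 1)) (w t) - ∫ x, g x (w t) ∂D) :=
  Finset.sum_range_succ _ _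

section Measurability

variable [SecondCountableTopology E] [MeasurableSpace E] [BorelSpace E]

theorem measurable_integral_of_uncurry [SFinite D] {g : X → E → E}
    (hg : Measurable fun p : X × E => g p.1 p.2) : Measurable fun w => ∫ x, g x w ∂D :=
  (hg.stronglyMeasurable.integral_prod_left' (μ := D)).measurable

end Measurability

variable [CompleteSpace E]

/-- The variance is at most the second moment. -/
theorem lintegral_enorm_sub_integral_sq_le [IsProbabilityMeasure D] {h : X → E}
    (hh : MemLp h 2 D) :
    ∫⁻ x, ‖h x - ∫ y, h y ∂D‖ₑ ^ 2 ∂D ≤ ∫⁻ x, ‖h x‖ₑ ^ 2 ∂D := by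
  set c := ∫ y, h y ∂D with hc
  have hi : Integrable h D := hh.integrable one_le_two
  have hsq : Integrable (fun x => ‖h x‖ ^ 2) D := (memLp_two_iff_integrable_sq_norm hh.1).1 hh
  rw [lintegral_enorm_sq_eq_ofReal_integral hh,
    lintegral_enorm_sq_eq_ofReal_integral (u := fun x => h x - c) (hh.sub (memLp_const c))]
  refine ENNReal.ofReal_le_ofReal ?_
  have hin : Integrable (fun x => 2 * inner ℝ c (h x)) D := (hi.const_inner c).const_mul 2
  have hdiff : Integrable (fun x => ‖h x‖ ^ 2 - 2 * inner ℝ c (h x)) D := hsq.sub hin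
  have hexp : ∀ x, ‖h x - c‖ ^ 2 = ‖h x‖ ^ 2 - 2 * inner ℝ c (h x) + ‖c‖ ^ 2 := fun x => by
    rw [norm_sub_sq_real, real_inner_comm]
  simp only [hexp]
  rw [integral_add hdiff (integrable_const _), integral_sub hsq hin,
    integral_const_mul, integral_inner hi, ← hc, real_inner_self_eq_norm_sq]
  simp only [integral_const, probReal_univ, one_smul]
  nlinarith [sq_nonneg ‖c‖]

variable [SecondCountableTopology E] [MeasurableSpace E] [BorelSpace E]

theorem lintegral_enorm_noise_sq_le [IsProbabilityMeasure μ] [IsProbabilityMeasure D]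
    (hm : m ≤ mΩ) {ξ : Ω → X} (hξ : Measurable ξ) (hlaw : μ.map ξ = D)
    (hind : Indep (MeasurableSpace.comap ξ inferInstance) m μ) {w : Ω → E} (hw : Measurable[m] w)
    {g : X → E → E} (hg : Measurable fun p : X × E => g p.1 p.2)
    (hg2 : ∀ w, MemLp (fun x => g x w) 2 D) :
    ∫⁻ ω, ‖g (ξ ω) (w ω) - ∫ x, g x (w ω) ∂D‖ₑ ^ 2 ∂μ ≤ ∫⁻ ω, ‖g (ξ ω) (w ω)‖ₑ ^ 2 ∂μ := by
  have hpair := map_prodMk_eq_prod_of_indep hm hξ hind hw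
  have hwm : Measurable w := hw.mono hm le_rfl
  have hξw : Measurable fun ω => (ξ ω, w ω) := hξ.prodMk hwm
  have hgb := measurable_integral_of_uncurry (D := D) hg
  have : IsProbabilityMeasure (μ.map w) := Measure.isProbabilityMeasure_map hwm.aemeasurable
  have h1 : Measurable fun p : X × E => ‖g p.1 p.2 - ∫ x, g x p.2 ∂D‖ₑ ^ 2 :=
    (hg.sub (hgb.comp measurable_snd)).enorm.pow_const 2
  have h2 : Measurable fun p : X × E => ‖g p.1 p.2‖ₑ ^ 2 := hg.enorm.pow_const 2
  rw [← lintegral_map h1 hξw, ← lintegral_map h2 hξw, hpair, hlaw,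
    lintegral_prod_symm _ h1.aemeasurable, lintegral_prod_symm _ h2.aemeasurable]
  exact lintegral_mono fun v => lintegral_enorm_sub_integral_sq_le (hg2 v)

/-- The noise is orthogonal to the past: integrate out the fresh sample first. -/
theorem integral_inner_noise_eq_zero [IsProbabilityMeasure μ] [IsProbabilityMeasure D]
    (hm : m ≤ mΩ) {ξ : Ω → X} (hξ : Measurable ξ) (hlaw : μ.map ξ = D)
    (hind : Indep (MeasurableSpace.comap ξ inferInstance) m μ) {w Y : Ω → E}
    (hw : Measurable[m] w) (hY : Measurable[m] Y)
    {g : X → E → E} (hg : Measurable fun p : X × E => g p.1 p.2)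
    (hg2 : ∀ w, MemLp (fun x => g x w) 2 D)
    (hint : Integrable (fun ω => inner ℝ (Y ω) (g (ξ ω) (w ω) - ∫ x, g x (w ω) ∂D)) μ) :
    ∫ ω, inner ℝ (Y ω) (g (ξ ω) (w ω) - ∫ x, g x (w ω) ∂D) ∂μ = 0 := by
  have hpair := map_prodMk_eq_prod_of_indep hm hξ hind (hw.prodMk hY)
  have hYw : Measurable fun ω => (w ω, Y ω) := (hw.prodMk hY).mono hm le_rfl
  have hξw : Measurable fun ω => (ξ ω, (w ω, Y ω)) := hξ.prodMk hYw
  have hgb := measurable_integral_of_uncurry (D := D) hg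
  have : IsProbabilityMeasure (μ.map fun ω => (w ω, Y ω)) :=
    Measure.isProbabilityMeasure_map hYw.aemeasurable
  have h1 : Measurable fun p : X × E × E =>
      (inner ℝ p.2.2 (g p.1 p.2.1 - ∫ x, g x p.2.1 ∂D) : ℝ) := by
    refine (measurable_snd.snd).inner (Measurable.sub ?_ (hgb.comp measurable_snd.fst))
    exact hg.comp (measurable_fst.prodMk measurable_snd.fst)
  have hint' := (integrable_map_measure h1.aestronglyMeasurable hξw.aemeasurable).2 hint
  have hmap := integral_map hξw.aemeasurable (μ := μ) h1.aestronglyMeasurable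
  refine hmap.symm.trans ?_
  rw [hpair, hlaw] at hint' ⊢
  rw [integral_prod_symm _ hint']
  refine integral_eq_zero_of_ae (.of_forall fun v => ?_)
  have hi : Integrable (fun x => g x v.1) D := (hg2 v.1).integrable one_le_two
  change ∫ x, inner ℝ v.2 (g x v.1 - ∫ y, g y v.1 ∂D) ∂D = 0
  have hsub : Integrable (fun x => g x v.1 - ∫ y, g y v.1 ∂D) D := hi.sub (integrable_const _)
  rw [integral_inner hsub, integral_sub hi (integrable_const _)]
  simp

/-- The increments of the accumulated noise are orthogonal to its past, so their second moments
add up. -/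
theorem accumulatedNoise_memLp_and_integral_le [IsProbabilityMeasure μ] [IsProbabilityMeasure D]
    (ℱ : Filtration ℕ mΩ) {ξ : ℕ → Ω → X} {w : ℕ → Ω → E} {g : X → E → E} (s : ℕ → ℝ) {K : ℝ≥0}
    (hξ : ∀ t, 1 ≤ t → Measurable[ℱ t] (ξ t)) (hlaw : ∀ t, 1 ≤ t → μ.map (ξ t) = D)
    (hind : ∀ t, 1 ≤ t → Indep (MeasurableSpace.comap (ξ t) inferInstance) (ℱ (t - 1)) μ)
    (hw : ∀ t, Measurable[ℱ t] (w t)) (hg : Measurable fun p : X × E => g p.1 p.2)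
    (hg2 : ∀ w, MemLp (fun x => g x w) 2 D)
    (hK : ∀ t, ∫⁻ ω, ‖g (ξ (t + 1) ω) (w t ω)‖ₑ ^ 2 ∂μ ≤ K) (t : ℕ) :
    MemLp (fun ω => accumulatedNoise D g s (fun k => ξ k ω) (fun k => w k ω) t) 2 μ ∧
    ∫ ω, ‖accumulatedNoise D g s (fun k => ξ k ω) (fun k => w k ω) t‖ ^ 2 ∂μ ≤
      K * ∑ k ∈ Finset.range t, s (k + 1) ^ 2 := by
  have hgb := measurable_integral_of_uncurry (D := D) hg
  have hnm : ∀ t, Measurable[ℱ (t + 1)]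
      fun ω => g (ξ (t + 1) ω) (w t ω) - ∫ x, g x (w t ω) ∂D := fun t => by
    have hw' := (hw t).mono (ℱ.mono (Nat.le_succ t)) le_rfl
    exact (hg.comp ((hξ (t + 1) (by omega)).prodMk hw')).sub (hgb.comp hw')
  have hMm : ∀ t, Measurable[ℱ t]
      fun ω => accumulatedNoise D g s (fun k => ξ k ω) (fun k => w k ω) t := fun t => by
    refine Finset.measurable_fun_sum _ fun k hk => ?_
    exact ((hnm k).mono (ℱ.mono (Finset.mem_range.1 hk)) le_rfl).const_smul _
  have hn : ∀ t, ∫⁻ ω, ‖g (ξ (t + 1) ω) (w t ω) - ∫ x, g x (w t ω) ∂D‖ₑ ^ 2 ∂μ ≤ K := fun t =>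
    (lintegral_enorm_noise_sq_le (ℱ.le t) ((hξ (t + 1) (by omega)).mono (ℱ.le _) le_rfl)
      (hlaw (t + 1) (by omega)) (hind (t + 1) (by omega)) (hw t) hg hg2).trans (hK t)
  have hnL : ∀ t, MemLp (fun ω => g (ξ (t + 1) ω) (w t ω) - ∫ x, g x (w t ω) ∂D) 2 μ := fun t =>
    memLp_two_of_lintegral_enorm_sq_lt_top
      ((hnm t).mono (ℱ.le _) le_rfl).aestronglyMeasurable ((hn t).trans_lt ENNReal.coe_lt_top)
  induction t with
  | zero => simp [accumulatedNoise]
  | succ t ih =>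
    obtain ⟨hL, hle⟩ := ih
    have hsL := (hnL t).const_smul (s (t + 1))
    simp only [accumulatedNoise_succ]
    refine ⟨hL.add hsL, ?_⟩
    have hi1 := (memLp_two_iff_integrable_sq_norm hL.1).1 hL
    have hi3 := (memLp_two_iff_integrable_sq_norm (hnL t).1).1 (hnL t)
    have hi2 : Integrable (fun ω => (inner ℝ
        (accumulatedNoise D g s (fun k => ξ k ω) (fun k => w k ω) t)
        (g (ξ (t + 1) ω) (w t ω) - ∫ x, g x (w t ω) ∂D) : ℝ)) μ := by
      refine (hi1.add hi3).mono' (hL.1.inner (hnL t).1) (.of_forall fun ω => ?_)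
      refine (norm_inner_le_norm _ _).trans ?_
      simp only [Pi.add_apply]
      nlinarith [two_mul_le_add_sq ‖accumulatedNoise D g s (fun k => ξ k ω) (fun k => w k ω) t‖
        ‖g (ξ (t + 1) ω) (w t ω) - ∫ x, g x (w t ω) ∂D‖,
        mul_nonneg (norm_nonneg (accumulatedNoise D g s (fun k => ξ k ω) (fun k => w k ω) t))
        (norm_nonneg (g (ξ (t + 1) ω) (w t ω) - ∫ x, g x (w t ω) ∂D))]
    have hi4 := (hi2.const_mul (s (t + 1))).const_mul 2
    have h0 := integral_inner_noise_eq_zero (ℱ.le t)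
      ((hξ (t + 1) (by omega)).mono (ℱ.le _) le_rfl) (hlaw (t + 1) (by omega))
      (hind (t + 1) (by omega)) (hw t) (hMm t) hg hg2 hi2
    have h1 := integral_norm_sq_le_of_lintegral_le (hnL t) (hn t)
    simp only [norm_add_sq_real, real_inner_smul_right, norm_smul, mul_pow, Real.norm_eq_abs,
      sq_abs]
    have hi5 : Integrable (fun ω =>
        ‖accumulatedNoise D g s (fun k => ξ k ω) (fun k => w k ω) t‖ ^ 2 +
        2 * (s (t + 1) * (inner ℝ (accumulatedNoise D g s (fun k => ξ k ω) (fun k => w k ω) t)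
        (g (ξ (t + 1) ω) (w t ω) - ∫ x, g x (w t ω) ∂D) : ℝ))) μ := hi1.add hi4
    rw [integral_add hi5 (hi3.const_mul _), integral_add hi1 hi4, integral_const_mul, integral_const_mul,
      integral_const_mul, h0, Finset.sum_range_succ]
    have := mul_le_mul_of_nonneg_left h1 (sq_nonneg (s (t + 1)))
    linarith

end Noise

/-! ### The expected loss and its gradient -/

section ExpectedLoss

variable {n : ℕ} {X : Type*} [MeasurableSpace X] {D : Measure X} {L : ℝ≥0}
  {f : X → EuclideanSpace ℝ (Fin n) → ℝ}

/-- Coordinates of the gradient are limits of difference quotients. -/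
theorem measurable_gradient_apply (hf : ∀ W, Measurable fun x => f x W)
    (hd : ∀ x, Differentiable ℝ (f x)) (W : EuclideanSpace ℝ (Fin n)) :
    Measurable fun x => gradient (f x) W := by
  have hcoord : ∀ i, Measurable fun x => gradient (f x) W i := fun i => by
    set v : EuclideanSpace ℝ (Fin n) := EuclideanSpace.single i 1
    refine measurable_of_tendsto_metrizable
      (f := fun (k : ℕ) x => (k : ℝ) * (f x (W + (k : ℝ)⁻¹ • v) - f x W))
      (fun k => ((hf _).sub (hf _)).const_mul _) (tendsto_pi_nhds.2 fun x => ?_)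
    have h := ((hd x W).hasGradientAt.hasFDerivAt.lim_real v).comp tendsto_natCast_atTop_atTop
    have hv : gradient (f x) W i = InnerProductSpace.toDual ℝ _ (gradient (f x) W) v := by
      rw [InnerProductSpace.toDual_apply_apply, EuclideanSpace.inner_single_right]
      simp
    rw [hv]
    exact h
  exact (WithLp.measurable_toLp 2 (Fin n → ℝ)).comp (measurable_pi_lambda _ hcoord)

/-- The gradient is a Carathéodory function: measurable in the sample, continuous in the point. -/
theorem measurable_gradient_uncurry (hf : ∀ W, Measurable fun x => f x W)
    (hL : ∀ x, IsLSmooth L (f x)) :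
    Measurable fun p : X × EuclideanSpace ℝ (Fin n) => gradient (f p.1) p.2 := by
  have h := measurable_uncurry_of_continuous_of_measurable
    (u := fun (W : EuclideanSpace ℝ (Fin n)) x => gradient (f x) W)
    (fun x => (hL x).2.continuous) (measurable_gradient_apply hf fun x => (hL x).1)
  exact h.comp measurable_swap

theorem memLp_gradient [IsProbabilityMeasure D] (hf : ∀ W, Measurable fun x => f x W)
    (hL : ∀ x, IsLSmooth L (f x)) {W₀ : EuclideanSpace ℝ (Fin n)}
    (h₀ : MemLp (fun x => gradient (f x) W₀) 2 D) (W : EuclideanSpace ℝ (Fin n)) :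
    MemLp (fun x => gradient (f x) W) 2 D := by
  have hm := measurable_gradient_apply hf fun x => (hL x).1
  have h : MemLp (fun x => gradient (f x) W - gradient (f x) W₀) 2 D :=
    MemLp.of_bound ((hm W).sub (hm W₀)).aestronglyMeasurable (L * ‖W - W₀‖)
      (.of_forall fun x => (hL x).2.norm_sub_le W W₀)
  refine (h₀.add h).ae_eq (.of_forall fun x => ?_)
  simp

theorem continuous_integral_gradient [IsProbabilityMeasure D] (hL : ∀ x, IsLSmooth L (f x))
    (hg : ∀ W, Integrable (fun x => gradient (f x) W) D) :
    Continuous fun W => ∫ x, gradient (f x) W ∂D := by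
  refine (LipschitzWith.of_dist_le_mul (K := L) fun W W' => ?_).continuous
  rw [dist_eq_norm, dist_eq_norm, ← integral_sub (hg W) (hg W')]
  refine (norm_integral_le_of_norm_le_const
    (.of_forall fun x => (hL x).2.norm_sub_le W W')).trans ?_
  simp

theorem hasGradientAt_integral [IsProbabilityMeasure D] (hL : ∀ x, IsLSmooth L (f x))
    (hf : ∀ W, Integrable (fun x => f x W) D)
    (hg : ∀ W, Integrable (fun x => gradient (f x) W) D) (W : EuclideanSpace ℝ (Fin n)) :
    HasGradientAt (fun W => ∫ x, f x W ∂D) (∫ x, gradient (f x) W ∂D) W := by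
  set T := InnerProductSpace.toDual ℝ (EuclideanSpace ℝ (Fin n)) with hT
  have hTm : AEStronglyMeasurable (fun x => T (gradient (f x) W)) D :=
    T.continuous.comp_aestronglyMeasurable (hg W).1
  have hTi : Integrable (fun x => T (gradient (f x) W)) D :=
    (hg W).mono hTm (.of_forall fun x => by simp)
  have h := hasFDerivAt_integral_of_dominated_of_fderiv_le (𝕜 := ℝ) (μ := D)
    (F := fun W x => f x W) (F' := fun W x => T (gradient (f x) W)) (x₀ := W)
    (bound := fun x => ‖gradient (f x) W‖ + L) (Metric.ball_mem_nhds W one_pos)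
    (.of_forall fun W => (hf W).1) (hf W) hTm
    (.of_forall fun x W' hW' => ?_) ((hg W).norm.add (integrable_const _))
    (.of_forall fun x W' _ => ((hL x).1 W').hasGradientAt.hasFDerivAt)
  · rw [hasGradientAt_iff_hasFDerivAt]
    refine h.congr_fderiv ?_
    ext y
    rw [ContinuousLinearMap.integral_apply hTi]
    simp only [hT, InnerProductSpace.toDual_apply_apply]
    rw [real_inner_comm, ← integral_inner (hg W)]
    simp only [real_inner_comm]
  · rw [LinearIsometryEquiv.norm_map]
    have h1 := (hL x).2.norm_sub_le W' W
    have h2 : ‖W' - W‖ ≤ 1 := by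
      rw [← dist_eq_norm]; exact (Metric.mem_ball.1 hW').le
    have h3 : (L : ℝ) * ‖W' - W‖ ≤ L := mul_le_of_le_one_right L.2 h2
    have h4 := norm_sub_norm_le (gradient (f x) W') (gradient (f x) W)
    linarith

end ExpectedLoss

namespace RAMDA

/-! ### A subsequence of vanishing noise and preconditioner -/

theorem sum_range_s (η : ℕ → ℝ) (t : ℕ) : ∑ k ∈ Finset.range t, s η (k + 1) = α η t := by
  induction t with
  | zero => simp [α]
  | succ t ih => rw [Finset.sum_range_succ, ih, α_succ]

/-- The average of the gradient noise, squared, plus a bound for all entries of `U^t / α_t ^ 3`: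
the quantity that has to vanish along a subsequence. -/
noncomputable def remainder {n : ℕ} {X : Type*} [MeasurableSpace X] (D : Measure X)
    (g : X → EuclideanSpace ℝ (Fin n) → EuclideanSpace ℝ (Fin n)) (η : ℕ → ℝ) (ξ : ℕ → X)
    (w : ℕ → EuclideanSpace ℝ (Fin n)) (t : ℕ) : ℝ :=
  ‖accumulatedNoise D g (s η) ξ w t‖ ^ 2 / α η t ^ 2 +
    (∑ k ∈ Finset.range t, s η (k + 1) * ‖g (ξ (k + 1)) (w k)‖ ^ 2) / α η t ^ 3

/-- The remainder tends to zero in mean, hence almost surely along a subsequence. -/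
theorem exists_subseq_remainder_tendsto_zero {n : ℕ} {X Ω : Type*} [MeasurableSpace X]
    {mΩ : MeasurableSpace Ω} {μ : Measure Ω} [IsProbabilityMeasure μ] {D : Measure X}
    [IsProbabilityMeasure D] (ℱ : Filtration ℕ mΩ) {ξ : ℕ → Ω → X}
    {w : ℕ → Ω → EuclideanSpace ℝ (Fin n)}
    {g : X → EuclideanSpace ℝ (Fin n) → EuclideanSpace ℝ (Fin n)} {K : ℝ≥0}
    (hξ : ∀ t, 1 ≤ t → Measurable[ℱ t] (ξ t)) (hlaw : ∀ t, 1 ≤ t → μ.map (ξ t) = D)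
    (hind : ∀ t, 1 ≤ t → Indep (MeasurableSpace.comap (ξ t) inferInstance) (ℱ (t - 1)) μ)
    (hw : ∀ t, Measurable[ℱ t] (w t))
    (hg : Measurable fun p : X × EuclideanSpace ℝ (Fin n) => g p.1 p.2)
    (hg2 : ∀ w, MemLp (fun x => g x w) 2 D)
    (hK : ∀ t, ∫⁻ ω, ‖g (ξ (t + 1) ω) (w t ω)‖ₑ ^ 2 ∂μ ≤ K)
    {η : ℕ → ℝ} (hη : ∀ t, 1 ≤ t → 0 < η t)
    (hs_sum : Tendsto (fun T => ∑ t ∈ Finset.Icc 1 T, s η t / α η t) atTop atTop)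
    (hs_sq : Summable fun t => (s η t / α η t) ^ 2) :
    ∃ ns : ℕ → ℕ, StrictMono ns ∧ ∀ᵐ ω ∂μ, Tendsto
      (fun k => remainder D g η (fun k => ξ k ω) (fun k => w k ω) (ns k)) atTop (𝓝 0) := by
  have hM := accumulatedNoise_memLp_and_integral_le ℱ (s η) hξ hlaw hind hw hg hg2 hK
  have hGm : ∀ t, Measurable fun ω => g (ξ (t + 1) ω) (w t ω) := fun t =>
    hg.comp (((hξ (t + 1) (by omega)).mono (ℱ.le _) le_rfl).prodMk
      ((hw t).mono (ℱ.le _) le_rfl))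
  have hG2 : ∀ t, MemLp (fun ω => g (ξ (t + 1) ω) (w t ω)) 2 μ := fun t =>
    memLp_two_of_lintegral_enorm_sq_lt_top (hGm t).aestronglyMeasurable
      ((hK t).trans_lt ENNReal.coe_lt_top)
  have hGi : ∀ t, Integrable (fun ω => s η (t + 1) * ‖g (ξ (t + 1) ω) (w t ω)‖ ^ 2) μ := fun t =>
    ((memLp_two_iff_integrable_sq_norm (hG2 t).1).1 (hG2 t)).const_mul _
  have hMi : ∀ t, Integrable (fun ω =>
      ‖accumulatedNoise D g (s η) (fun k => ξ k ω) (fun k => w k ω) t‖ ^ 2 / α η t ^ 2) μ :=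
    fun t => ((memLp_two_iff_integrable_sq_norm (hM t).1.1).1 (hM t).1).div_const _
  have hSi : ∀ t, Integrable (fun ω => (∑ k ∈ Finset.range t,
      s η (k + 1) * ‖g (ξ (k + 1) ω) (w k ω)‖ ^ 2) / α η t ^ 3) μ := fun t =>
    (integrable_finsetSum _ fun k _ => hGi k).div_const _
  have hs : ∀ k, 0 ≤ s η (k + 1) := fun k => (s_pos hη (by omega)).le
  have h0 : ∀ t ω, 0 ≤ remainder D g η (fun k => ξ k ω) (fun k => w k ω) t := fun t ω =>
    add_nonneg (by positivity) (div_nonneg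
      (Finset.sum_nonneg fun k _ => mul_nonneg (hs k) (sq_nonneg _))
      (pow_nonneg (α_nonneg hη t) 3))
  refine exists_subseq_ae_tendsto_zero
    (R := fun t ω => remainder D g η (fun k => ξ k ω) (fun k => w k ω) t) (fun t => (hMi t).add (hSi t)) h0 ?_
  have hlim : Tendsto (fun t => K * ((∑ k ∈ Finset.range t, s η (k + 1) ^ 2) / α η t ^ 2) +
      K * (α η t ^ 2)⁻¹) atTop (𝓝 0) := by
    have h1 := (tendsto_sum_sq_div_α_sq hη hs_sum hs_sq).const_mul (K : ℝ)
    have h2 := (tendsto_inv_atTop_zero.comp ((tendsto_pow_atTop two_ne_zero).comp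
      (tendsto_α hη hs_sum))).const_mul (K : ℝ)
    simpa using h1.add h2
  refine squeeze_zero (fun t => integral_nonneg (h0 t)) (fun t => ?_) hlim
  unfold remainder
  rw [integral_add (hMi t) (hSi t), integral_div, integral_div,
    integral_finsetSum _ fun k _ => hGi k]
  refine add_le_add ?_ ?_
  · rw [← mul_div_assoc]
    exact div_le_div_of_nonneg_right (hM t).2 (sq_nonneg _)
  · have hle : ∑ k ∈ Finset.range t, ∫ ω, s η (k + 1) * ‖g (ξ (k + 1) ω) (w k ω)‖ ^ 2 ∂μ ≤
        K * α η t := by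
      rw [← sum_range_s, Finset.mul_sum]
      refine Finset.sum_le_sum fun k _ => ?_
      rw [integral_const_mul, mul_comm]
      exact mul_le_mul_of_nonneg_right
        (integral_norm_sq_le_of_lintegral_le (hG2 k) (hK k)) (hs k)
    refine (div_le_div_of_nonneg_right hle (pow_nonneg (α_nonneg hη t) 3)).trans_eq ?_
    by_cases hα : α η t = 0
    · simp [hα]
    · field_simp

theorem measurable_iterate {n : ℕ} {Ω : Type*} {mΩ : MeasurableSpace Ω} (ℱ : Filtration ℕ mΩ)
    {What : ℕ → Ω → EuclideanSpace ℝ (Fin n)} (h : ∀ t, 1 ≤ t → Measurable[ℱ t] (What t))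
    (c : ℕ → ℝ) (W0 : EuclideanSpace ℝ (Fin n)) (t : ℕ) :
    Measurable[ℱ t] fun ω => iterate c W0 (fun k => What k ω) t := by
  induction t with
  | zero => exact measurable_const
  | succ t ih =>
    have h1 := (ih.mono (ℱ.mono (Nat.le_succ t)) le_rfl).const_smul (1 - c (t + 1))
    exact h1.add ((h (t + 1) (by omega)).const_smul (c (t + 1)))

/-! ### Limits along one sample path -/

section Path

variable {n : ℕ} {X : Type*} {f : X → EuclideanSpace ℝ (Fin n) → ℝ}
  {ψ : EuclideanSpace ℝ (Fin n) → EReal}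
  {η c e : ℕ → ℝ} {ε : ℝ} {W0 Wbar : EuclideanSpace ℝ (Fin n)} {ξ : ℕ → X}
  {What : ℕ → EuclideanSpace ℝ (Fin n)}
  {g : X → EuclideanSpace ℝ (Fin n) → EuclideanSpace ℝ (Fin n)}

/-- Nonnegativity of the entries of `U^t` is what makes the real powers in `P^t` genuine cube
roots. -/
theorem U_nonneg_and_le (hη : ∀ t, 1 ≤ t → 0 < η t)
    (hG : ∀ t, G f c W0 ξ What (t + 1) = g (ξ (t + 1)) (iterate c W0 What t)) (t : ℕ)
    (i : Fin n) : 0 ≤ U f η c W0 ξ What t i ∧ U f η c W0 ξ What t i ≤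
      ∑ k ∈ Finset.range t, s η (k + 1) * ‖g (ξ (k + 1)) (iterate c W0 What k)‖ ^ 2 := by
  induction t with
  | zero => simp [U]
  | succ t ih =>
    have hs := (s_pos hη (t := t + 1) (by omega)).le
    have hU : U f η c W0 ξ What (t + 1) i = U f η c W0 ξ What t i +
        s η (t + 1) * G f c W0 ξ What (t + 1) i ^ 2 := by
      simp [U, hadamard, sq]
    have hle : G f c W0 ξ What (t + 1) i ^ 2 ≤ ‖G f c W0 ξ What (t + 1)‖ ^ 2 := by
      rw [← sq_abs, ← Real.norm_eq_abs]
      exact pow_le_pow_left₀ (norm_nonneg _) (PiLp.norm_apply_le _ i) 2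
    rw [hU, Finset.sum_range_succ, ← hG]
    exact ⟨add_nonneg ih.1 (mul_nonneg hs (sq_nonneg _)),
      add_le_add ih.2 (mul_le_mul_of_nonneg_left hle hs)⟩

variable [MeasurableSpace X] {D : Measure X}

/-- Without the noise, `V^t / α_t` is a weighted average of mean gradients at the iterates. -/
theorem tendsto_V_sub_noise (hη : ∀ t, 1 ≤ t → 0 < η t)
    (hs_sum : Tendsto (fun T => ∑ t ∈ Finset.Icc 1 T, s η t / α η t) atTop atTop)
    (hG : ∀ t, G f c W0 ξ What (t + 1) = g (ξ (t + 1)) (iterate c W0 What t))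
    (hg : Continuous fun w => ∫ x, g x w ∂D)
    (hW : Tendsto (iterate c W0 What) atTop (𝓝 Wbar)) :
    Tendsto (fun t => (α η t)⁻¹ • (V f η c W0 ξ What t -
      accumulatedNoise D g (s η) ξ (iterate c W0 What) t)) atTop (𝓝 (∫ x, g x Wbar ∂D)) := by
  set gb := fun w => ∫ x, g x w ∂D with hgb
  set A : ℕ → EuclideanSpace ℝ (Fin n) := fun t => V f η c W0 ξ What t -
    accumulatedNoise D g (s η) ξ (iterate c W0 What) t with hA
  have hAs : ∀ t, A (t + 1) = A t + s η (t + 1) • gb (iterate c W0 What t) := fun t => by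
    simp only [hA, V, accumulatedNoise_succ, hG, hgb]
    module
  have hb : Tendsto (fun t => ‖gb (iterate c W0 What (t - 1)) - gb Wbar‖) atTop (𝓝 0) := by
    rw [← tendsto_iff_norm_sub_tendsto_zero]
    exact ((hg.tendsto Wbar).comp hW).comp (tendsto_sub_atTop_nat 1)
  have key := tendsto_div_α hη hs_sum (p := fun t => ‖A t - α η t • gb Wbar‖)
    (fun _ => norm_nonneg _) (by simp [hA, V, accumulatedNoise, α_zero]) hb fun t => ?_
  · rw [tendsto_iff_norm_sub_tendsto_zero]
    refine key.congr' ?_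
    filter_upwards [eventually_ge_atTop 1] with t ht
    have hα := α_pos hη ht
    have : (α η t)⁻¹ • A t - gb Wbar = (α η t)⁻¹ • (A t - α η t • gb Wbar) := by
      rw [smul_sub _ (A t), inv_smul_smul₀ hα.ne']
    change _ = ‖(α η t)⁻¹ • A t - gb Wbar‖
    rw [this, norm_smul, Real.norm_of_nonneg (inv_nonneg.2 hα.le), div_eq_inv_mul]
  · have : A (t + 1) - α η (t + 1) • gb Wbar = (A t - α η t • gb Wbar) +
        s η (t + 1) • (gb (iterate c W0 What t) - gb Wbar) := by
      rw [hAs, α_succ]; module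
    rw [this]
    refine (norm_add_le _ _).trans_eq ?_
    rw [norm_smul, Real.norm_of_nonneg (s_pos hη (by omega)).le, Nat.add_sub_cancel]

/-- Where the remainder vanishes, so does the preconditioner on the scale `α_t`, because
`∛(U^t) / α_t = ∛(U^t / α_t ^ 3)`. -/
theorem tendsto_P_entry (hη : ∀ t, 1 ≤ t → 0 < η t)
    (hs_sum : Tendsto (fun T => ∑ t ∈ Finset.Icc 1 T, s η t / α η t) atTop atTop)
    (hG : ∀ t, G f c W0 ξ What (t + 1) = g (ξ (t + 1)) (iterate c W0 What t))
    {ns : ℕ → ℕ} (hns : Tendsto ns atTop atTop)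
    (hR : Tendsto (fun k => remainder D g η ξ (iterate c W0 What) (ns k)) atTop (𝓝 0))
    (i : Fin n) :
    Tendsto (fun k => (α η (ns k))⁻¹ * (U f η c W0 ξ What (ns k) i ^ (1 / 3 : ℝ) + ε))
      atTop (𝓝 0) := by
  have hα3 : ∀ t, 0 ≤ α η t ^ 3 := fun t => pow_nonneg (α_nonneg hη t) 3
  have hU : Tendsto (fun k => U f η c W0 ξ What (ns k) i / α η (ns k) ^ 3) atTop (𝓝 0) := by
    refine squeeze_zero (fun k => div_nonneg (U_nonneg_and_le hη hG _ i).1 (hα3 _))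
      (fun k => ?_) hR
    refine (div_le_div_of_nonneg_right (U_nonneg_and_le hη hG _ i).2 (hα3 _)).trans ?_
    exact le_add_of_nonneg_left (by positivity)
  have h1 : Tendsto (fun k => (U f η c W0 ξ What (ns k) i / α η (ns k) ^ 3) ^ (1 / 3 : ℝ))
      atTop (𝓝 0) := by
    have := hU.rpow_const (p := 1 / 3) (Or.inr (by norm_num))
    rwa [Real.zero_rpow (by norm_num)] at this
  have h2 : Tendsto (fun k => (α η (ns k))⁻¹ * ε) atTop (𝓝 0) := by
    simpa using (tendsto_inv_atTop_zero.comp ((tendsto_α hη hs_sum).comp hns)).mul_const ε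
  refine (by simpa using h1.add h2 : Tendsto _ atTop (𝓝 (0 : ℝ))).congr fun k => ?_
  have hroot : (α η (ns k) ^ 3) ^ (1 / 3 : ℝ) = α η (ns k) := by
    have := Real.pow_rpow_inv_natCast (α_nonneg hη (ns k)) (n := 3) (by norm_num)
    simpa using this
  have h3 := Real.div_rpow (U_nonneg_and_le hη hG (ns k) i).1 (hα3 (ns k)) (1 / 3 : ℝ)
  rw [hroot] at h3
  simp only [one_div] at h3 ⊢
  rw [h3, mul_add, div_eq_inv_mul]

theorem tendsto_noise_div_α (hη : ∀ t, 1 ≤ t → 0 < η t)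
    {w : ℕ → EuclideanSpace ℝ (Fin n)} {ns : ℕ → ℕ}
    (hR : Tendsto (fun k => remainder D g η ξ w (ns k)) atTop (𝓝 0)) :
    Tendsto (fun k => (α η (ns k))⁻¹ • accumulatedNoise D g (s η) ξ w (ns k)) atTop (𝓝 0) := by
  have h : Tendsto (fun k => ‖accumulatedNoise D g (s η) ξ w (ns k)‖ ^ 2 / α η (ns k) ^ 2)
      atTop (𝓝 0) := by
    refine squeeze_zero (fun k => by positivity) (fun k => ?_) hR
    exact le_add_of_nonneg_right (div_nonneg (Finset.sum_nonneg fun j _ =>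
      mul_nonneg (s_pos hη (by omega)).le (sq_nonneg _)) (pow_nonneg (α_nonneg hη _) 3))
  rw [tendsto_zero_iff_norm_tendsto_zero]
  have h2 := h.sqrt
  rw [Real.sqrt_zero] at h2
  refine h2.congr fun k => ?_
  rw [← div_pow, Real.sqrt_sq (div_nonneg (norm_nonneg _) (α_nonneg hη _)), norm_smul,
    Real.norm_of_nonneg (inv_nonneg.2 (α_nonneg hη _)), div_eq_inv_mul]

/-- Dividing the inexact optimality condition of the subproblem by `α_t` gives subgradients of
`ψ` at `What^t` that converge, along the subsequence, to minus the mean gradient at `Wbar`. -/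
theorem neg_integral_gradient_mem_limitingSubdifferential (hη : ∀ t, 1 ≤ t → 0 < η t)
    (hs_sum : Tendsto (fun T => ∑ t ∈ Finset.Icc 1 T, s η t / α η t) atTop atTop)
    (he : Tendsto e atTop (𝓝 0))
    (hG : ∀ t, G f c W0 ξ What (t + 1) = g (ξ (t + 1)) (iterate c W0 What t))
    (hg : Continuous fun w => ∫ x, g x w ∂D)
    (hinex : ∀ t, 1 ≤ t → Inexact f ψ η c e ε W0 ξ What t)
    (hWhat : Tendsto What atTop (𝓝 Wbar))
    (hW : Tendsto (iterate c W0 What) atTop (𝓝 Wbar))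
    (hosc : OuterSemicontinuousAt (limitingSubdifferential ψ) Wbar)
    {ns : ℕ → ℕ} (hns : Tendsto ns atTop atTop) (hns1 : ∀ k, 1 ≤ ns k)
    (hR : Tendsto (fun k => remainder D g η ξ (iterate c W0 What) (ns k)) atTop (𝓝 0)) :
    -∫ x, g x Wbar ∂D ∈ limitingSubdifferential ψ Wbar := by
  choose v hv hve using fun k => (hinex (ns k) (hns1 k)).1
  set T := fun t => Matrix.toEuclideanLin (P f η c ε W0 ξ What t) with hT
  have hmem : ∀ k, (α η (ns k))⁻¹ • (v k - (V f η c W0 ξ What (ns k) +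
      T (ns k) (What (ns k) - W0))) ∈ limitingSubdifferential ψ (What (ns k)) := fun k =>
    inv_smul_sub_gradient_mem_limitingSubdifferential
      (g' := fun w => V f η c W0 ξ What (ns k) + T (ns k) (w - W0)) (α_pos hη (hns1 k))
      (hasGradientAt_linear_add_quadratic _ _ _)
      (continuous_const.add ((T (ns k)).toContinuousLinearMap.continuous.comp
        (continuous_id.sub continuous_const))) (hv k)
  refine hosc _ _ _ (hWhat.comp hns) hmem ?_
  have hα := (tendsto_α hη hs_sum).comp hns
  have hαinv : Tendsto (fun k => (α η (ns k))⁻¹) atTop (𝓝 0) := tendsto_inv_atTop_zero.comp hα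
  have hv0 : Tendsto (fun k => (α η (ns k))⁻¹ • v k) atTop (𝓝 0) := by
    have : Tendsto v atTop (𝓝 0) := squeeze_zero_norm hve (he.comp hns)
    simpa using hαinv.smul this
  have hP0 : Tendsto (fun k => (α η (ns k))⁻¹ • T (ns k) (What (ns k) - W0)) atTop (𝓝 0) := by
    have hcoord : Tendsto (fun k i => ((α η (ns k))⁻¹ • T (ns k) (What (ns k) - W0)) i) atTop
        (𝓝 (0 : Fin n → ℝ)) := by
      refine tendsto_pi_nhds.2 fun i => ?_
      have h1 : Tendsto (fun k => (What (ns k) - W0) i) atTop (𝓝 ((Wbar - W0) i)) :=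
        ((PiLp.continuous_apply 2 (fun _ : Fin n => ℝ) i).tendsto _).comp
          ((hWhat.comp hns).sub_const W0)
      have h2 := (tendsto_P_entry (ε := ε) hη hs_sum hG hns hR i).mul h1
      rw [zero_mul] at h2
      refine h2.congr fun k => ?_
      simp [hT, P, Matrix.toLpLin_apply, Matrix.mulVec_diagonal, mul_assoc]
    exact ((PiLp.continuous_toLp 2 (fun _ : Fin n => ℝ)).tendsto _).comp hcoord
  have hM := tendsto_noise_div_α hη hR
  have hV := (tendsto_V_sub_noise (D := D) hη hs_sum hG hg hW).comp hns
  have hlim := ((hv0.sub hV).sub hM).sub hP0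
  rw [zero_sub, sub_zero, sub_zero] at hlim
  refine hlim.congr fun k => ?_
  rw [Function.comp_apply]
  module

end Path

end RAMDA

/-! ### Stationarity of the limit -/

theorem mem_stationarySet_objective {n : ℕ} {X : Type*} [MeasurableSpace X] {D : Measure X}
    {f : X → EuclideanSpace ℝ (Fin n) → ℝ} {ψ : EuclideanSpace ℝ (Fin n) → EReal}
    {gb : EuclideanSpace ℝ (Fin n) → EuclideanSpace ℝ (Fin n)} {W : EuclideanSpace ℝ (Fin n)}
    (hF : ∀ W, HasGradientAt (fun W => ∫ x, f x W ∂D) (gb W) W) (hgb : Continuous gb)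
    (h : -gb W ∈ limitingSubdifferential ψ W) : W ∈ stationarySet (objective D f ψ) := by
  have h := smul_add_gradient_mem_limitingSubdifferential one_pos hF hgb h
  have hobj : (fun y => ((1 : ℝ) : EReal) * ψ y + ((∫ x, f x y ∂D : ℝ) : EReal)) =
      objective D f ψ := by
    funext y; rw [objective, EReal.coe_one, one_mul, add_comm]
  rw [hobj, one_smul, neg_add_cancel] at h
  exact h

namespace RAMDA

/-- A point to which the subproblem solutions converge with positive probability is stationary.
Since this is not a random assertion, one sample path suffices: a path in the event along which
the remainder vanishes on the almost sure subsequence. -/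
theorem mem_stationarySet_of_measure_tendsto_ne_zero {n : ℕ} {X Ω : Type*}
    [MeasurableSpace X] {mΩ : MeasurableSpace Ω}
    (μ : Measure Ω) [IsProbabilityMeasure μ] (ℱ : Filtration ℕ mΩ)
    (D : Measure X) [IsProbabilityMeasure D]
    (f : X → EuclideanSpace ℝ (Fin n) → ℝ) (ψ : EuclideanSpace ℝ (Fin n) → EReal)
    (hf_meas : ∀ W, Measurable fun x => f x W)
    (hf_int : ∀ W, Integrable (fun x => f x W) D)
    (η c e : ℕ → ℝ) (ε : ℝ) (hη : ∀ t, 1 ≤ t → 0 < η t)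
    (hc : ∀ t, 1 ≤ t → c t ∈ Set.Icc (0 : ℝ) 1)
    (hc_sum : Tendsto (fun T => ∑ t ∈ Finset.Icc 1 T, c t) atTop atTop)
    (he_sum : Summable fun t => e t ^ 2)
    (W0 : EuclideanSpace ℝ (Fin n))
    (ξ : ℕ → Ω → X) (What : ℕ → Ω → EuclideanSpace ℝ (Fin n))
    (hrun : IsRun μ ℱ D f ψ η c e ε W0 ξ What)
    (L : ℝ≥0) (hL : ∀ᵐ x ∂D, IsLSmooth L (f x))
    (C : ℝ≥0) (hC : ∀ t, 1 ≤ t →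
      ∫⁻ ω, ‖G f c W0 (fun k => ξ k ω) (fun k => What k ω) t‖ₑ ^ 4 ∂μ ≤ C)
    (hs_sum : Tendsto (fun T => ∑ t ∈ Finset.Icc 1 T, s η t / α η t) atTop atTop)
    (hs_sq : Summable fun t => (s η t / α η t) ^ 2)
    (Wbar : EuclideanSpace ℝ (Fin n))
    (hosc : OuterSemicontinuousAt (limitingSubdifferential ψ) Wbar)
    (hpos : μ {ω | Tendsto (fun t => What t ω) atTop (𝓝 Wbar)} ≠ 0) :
    Wbar ∈ stationarySet (objective D f ψ) := by
  -- Redefine `f x` as `0` for `x` in a null set, so that every `f x` is `L`-smooth, which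
  -- makes the gradient jointly measurable.
  obtain ⟨S, hSD, hSm, hS⟩ := hL.exists_measurable_mem
  set f' : X → EuclideanSpace ℝ (Fin n) → ℝ := fun x W => S.indicator (fun x => f x W) x with hf'
  have hf'S : ∀ x ∈ S, f' x = f x := fun x hx => by
    funext W; simp [hf', hx]
  have hf'm : ∀ W, Measurable fun x => f' x W := fun W => (hf_meas W).indicator hSm
  have hf'L : ∀ x, IsLSmooth L (f' x) := fun x => by
    by_cases hx : x ∈ S
    · rw [hf'S x hx]; exact hS x hx
    · have h0 : f' x = fun _ => 0 := by funext W; simp [hf', hx]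
      rw [h0]
      refine ⟨differentiable_const _, ?_⟩
      have : gradient (fun _ : EuclideanSpace ℝ (Fin n) => (0 : ℝ)) = fun _ => 0 := by
        funext W; exact gradient_const W 0
      rw [this]
      exact LipschitzWith.const' _
  have hff' : ∀ W, (fun x => f' x W) =ᵐ[D] fun x => f x W := fun W => by
    filter_upwards [hSD] with x hx using by rw [hf'S x hx]
  set g : X → EuclideanSpace ℝ (Fin n) → EuclideanSpace ℝ (Fin n) :=
    fun x W => gradient (f' x) W with hgdef
  have hξm : ∀ t, 1 ≤ t → Measurable (ξ t) := fun t ht =>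
    (hrun.sample_measurable t ht).mono (ℱ.le _) le_rfl
  have hξS : ∀ᵐ ω ∂μ, ∀ t, 1 ≤ t → ξ t ω ∈ S := by
    rw [ae_all_iff]
    intro t
    by_cases ht : 1 ≤ t
    · have : ∀ᵐ x ∂(μ.map (ξ t)), x ∈ S := by rw [hrun.sample_law t ht]; exact hSD
      filter_upwards [ae_of_ae_map (hξm t ht).aemeasurable this] with ω hω _ using hω
    · exact .of_forall fun ω h => absurd h ht
  have hG : ∀ ω, (∀ t, 1 ≤ t → ξ t ω ∈ S) → ∀ t,
      G f c W0 (fun k => ξ k ω) (fun k => What k ω) (t + 1) =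
        g (ξ (t + 1) ω) (iterate c W0 (fun k => What k ω) t) := fun ω hω t => by
    simp only [G, hgdef, Nat.add_sub_cancel, hf'S _ (hω (t + 1) (by omega))]
  have hK : ∀ t, ∫⁻ ω, ‖g (ξ (t + 1) ω) (iterate c W0 (fun k => What k ω) t)‖ₑ ^ 2 ∂μ ≤
      ((1 + C : ℝ≥0) : ℝ≥0∞) := fun t => by
    -- Second moments are bounded by fourth moments through `x ^ 2 ≤ 1 + x ^ 4`.
    calc _ ≤ ∫⁻ ω, (1 + ‖G f c W0 (fun k => ξ k ω) (fun k => What k ω) (t + 1)‖ₑ ^ 4) ∂μ := by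
          refine lintegral_mono_ae ?_
          filter_upwards [hξS] with ω hω
          rw [← hG ω hω t]
          rcases le_total ‖G f c W0 (fun k => ξ k ω) (fun k => What k ω) (t + 1)‖ₑ 1 with h | h
          · exact (pow_le_one' h 2).trans le_self_add
          · exact (pow_le_pow_right₀ h (by norm_num)).trans le_add_self
      _ ≤ ((1 + C : ℝ≥0) : ℝ≥0∞) := by
          rw [lintegral_add_left measurable_const]
          simpa using add_le_add_right (hC (t + 1) (by omega)) 1
  have hgm := measurable_gradient_uncurry hf'm hf'L
  -- The first iterate is deterministic, so the moment bound at `t = 1` is one on `∇f_x(W0)`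
  -- under `D`; the Lipschitz property carries it to all other points.
  have hg0 : MemLp (fun x => g x W0) 2 D := by
    have hm := measurable_gradient_apply hf'm (fun x => (hf'L x).1) W0
    refine memLp_two_of_lintegral_enorm_sq_lt_top hm.aestronglyMeasurable ?_
    rw [← hrun.sample_law 1 le_rfl, lintegral_map (hm.enorm.pow_const 2) (hξm 1 le_rfl)]
    exact (hK 0).trans_lt ENNReal.coe_lt_top
  have hg2 := memLp_gradient hf'm hf'L hg0
  have hgi : ∀ W, Integrable (fun x => g x W) D := fun W => (hg2 W).integrable one_le_two
  have hgc : Continuous fun W => ∫ x, g x W ∂D := continuous_integral_gradient hf'L hgi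
  obtain ⟨ns, hns, hR⟩ := exists_subseq_remainder_tendsto_zero ℱ hrun.sample_measurable
    hrun.sample_law hrun.sample_indep (measurable_iterate ℱ hrun.adapted c W0) hgm hg2 hK hη
    hs_sum hs_sq
  obtain ⟨ω, hω, hωS, hωR, hωI⟩ := ((frequently_ae_mem_iff.2 hpos).and_eventually
    (hξS.and (hR.and hrun.inexact))).exists
  -- The index shift avoids the possible value `ns 0 = 0`, where there is no subproblem.
  have hns' : Tendsto (fun k => ns (k + 1)) atTop atTop :=
    hns.tendsto_atTop.comp (tendsto_add_atTop_nat 1)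
  refine mem_stationarySet_objective (gb := fun W => ∫ x, g x W ∂D) (fun W => ?_) hgc
    (neg_integral_gradient_mem_limitingSubdifferential hη hs_sum
      (tendsto_zero_of_summable_sq he_sum) (hG ω hωS) hgc hωI hω
      (tendsto_iterate hc hc_sum W0 hω) hosc hns'
      (fun k => (Nat.succ_le_succ (Nat.zero_le k)).trans (hns.id_le (k + 1)))
      (hωR.comp (tendsto_add_atTop_nat 1)))
  have h := hasGradientAt_integral hf'L (fun W => (hf_int W).congr (hff' W).symm) hgi W
  have heq : (fun W => ∫ x, f' x W ∂D) = fun W => ∫ x, f x W ∂D :=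
    funext fun W => integral_congr_ae (hff' W)
  rwa [heq] at h

end RAMDA

theorem theorem2 {n : ℕ} {X Ω : Type*} [MeasurableSpace X] {mΩ : MeasurableSpace Ω}
    (μ : Measure Ω) [IsProbabilityMeasure μ] (ℱ : Filtration ℕ mΩ)
    (D : Measure X) [IsProbabilityMeasure D]
    (f : X → EuclideanSpace ℝ (Fin n) → ℝ) (ψ : EuclideanSpace ℝ (Fin n) → EReal)
    -- the expected loss is well defined
    (hf_meas : ∀ W, Measurable fun x => f x W)
    (hf_int : ∀ W, Integrable (fun x => f x W) D)
    -- the parameters of the algorithm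
    (η c e : ℕ → ℝ) (ε : ℝ) (hη : ∀ t, 1 ≤ t → 0 < η t)
    (hc : ∀ t, 1 ≤ t → c t ∈ Set.Icc (0 : ℝ) 1) (hε : 0 < ε)
    (hc_sum : Tendsto (fun T => ∑ t ∈ Finset.Icc 1 T, c t) atTop atTop)
    (he_sum : Summable fun t => e t ^ 2)
    -- a run of the algorithm
    (W0 : EuclideanSpace ℝ (Fin n))
    (ξ : ℕ → Ω → X) (What : ℕ → Ω → EuclideanSpace ℝ (Fin n))
    (hrun : RAMDA.IsRun μ ℱ D f ψ η c e ε W0 ξ What)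
    -- smoothness and bounded fourth moments
    (L : ℝ≥0) (hL : ∀ᵐ x ∂D, IsLSmooth L (f x))
    (C : ℝ≥0) (hC : ∀ t, 1 ≤ t →
      ∫⁻ ω, ‖RAMDA.G f c W0 (fun k => ξ k ω) (fun k => What k ω) t‖ₑ ^ 4 ∂μ ≤ C)
    (hZ : (stationarySet (objective D f ψ)).Nonempty)
    -- the step-size conditions
    (hs_sum : Tendsto (fun T => ∑ t ∈ Finset.Icc 1 T, RAMDA.s η t / RAMDA.α η t) atTop atTop)
    (hs_sq : Summable fun t => (RAMDA.s η t / RAMDA.α η t) ^ 2)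
    (hs_diff : ∀ᵐ ω ∂μ, Tendsto (fun t =>
      ‖RAMDA.iterate c W0 (fun k => What k ω) (t + 1) -
        RAMDA.iterate c W0 (fun k => What k ω) t‖ * (RAMDA.s η t / RAMDA.α η t)⁻¹)
      atTop (𝓝 0))
    -- the event of convergence to a given point
    (Wbar : EuclideanSpace ℝ (Fin n))
    (hosc : OuterSemicontinuousAt (limitingSubdifferential ψ) Wbar)
    (hpos : μ {ω | Tendsto (fun t => What t ω) atTop (𝓝 Wbar)} ≠ 0) :
    (∀ᵐ _ω ∂μ[|{ω | Tendsto (fun t => What t ω) atTop (𝓝 Wbar)}],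
      Wbar ∈ stationarySet (objective D f ψ)) ∧
    ∀ ω, Tendsto (fun t => What t ω) atTop (𝓝 Wbar) →
      Tendsto (fun t => RAMDA.iterate c W0 (fun k => What k ω) t) atTop (𝓝 Wbar) := by
  refine ⟨.of_forall fun _ => ?_, fun ω hω => RAMDA.tendsto_iterate hc hc_sum W0 hω⟩
  exact RAMDA.mem_stationarySet_of_measure_tendsto_ne_zero μ ℱ D f ψ hf_meas hf_int η c e ε hη hc
    hc_sum he_sum W0 ξ What hrun L hL C hC hs_sum hs_sq Wbar hosc hpos
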